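/- Let $n\ge 2$, $\mathcal N=\{1,\dots,n\}$ and $A=[a_{i,j}]\in\mathbb C^{n\times n}$. For a complex matrix $B=[b_{i,j}]$ of order $n$ put $r_i(B)=\sum_{j\ne i}|b_{i,j}|$ and $c_i(B)=\sum_{j\neq i}|b_{j,i}|$. Let $\tilde r_i(B)$ and $\tilde c_i(B)$ be the same sums restricted to those $j\ne i$ that lie in the same irreducible diagonal block of the Frobenius normal form of $B$ as $i$ (equivalently, in the same strongly connected component of the directed graph with edges $k\to l$ for $b_{k,l}\neq0$). Let $D_n^P$ be the set of diagonal matrices of order $n$ with positive diagonal entries, and for $X\in D^P_n$ let $r^X(A)=r(X^{-1}AX)$, and likewise $c^X,\tilde r^X,\tilde c^X$. Write $A\in GDD$ if there is $X\in D^P_n$ with $|a_{i,i}|>r_i^X(A)$ for all $i\in\mathcal N$. A function $f=(f_1,\dots,f_n):\mathbb C^{n\times n}\to[0,\infty)^n$, such that $f(B)$ depends only on the moduli of the off-diagonal entries of $B$, is a $G$-function if every $B=[b_{i,j}]\in\mathbb C^{n\times n}$ with $|b_{i,i}|>f_i(B)$ for all $i$ is nonsingular. Let $\mathcal G_n$ be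 the set of $G$-functions. Convention: $0^0=1$. **Theorem 4.4.** $A\in GDD$ provided there exist $g,h\in\mathcal G_n$ and $\alpha,\beta\in[0,1]$ such that one of the following eight conditions holds (the same condition for all $i,j\in\mathcal N$, $i\ne j$; we write $g_i=g_i(A)$, $h_i=h_i(A)$): 1. $|a_{i,i}||a_{j,j}|>[\alpha g_i+(1-\alpha)h_j][\alpha g_j+(1-\alpha)h_i]$; 2. $|a_{i,i}||a_{j,j}|>[\alpha g_i+(1-\alpha)g_j][\alpha h_j+(1-\alpha)h_i]$; 3. $|a_{i,i}|^\alpha|a_{j,j}|^{1-\alpha}>\alpha g_i+(1-\alpha)g_j$; 4. $|a_{i,i}|^\alpha|a_{j,j}|^{1-\alpha}>\alpha g_i+(1-\alpha)h_j$; 5. $|a_{i,i}|^\alpha|a_{j,j}|^{1-\alpha}>\alpha g_i^\beta h_i^{1-\beta}+(1-\alpha)g_j^\beta h_j^{1-\beta}$; 6. $|a_{i,i}|^\alpha|a_{j,j}|^{1-\alpha}>\alpha g_i^\beta h_i^{1-\beta}+(1-\alpha)h_j^\beta g_j^{1-\beta}$; 7. $|a_{i,i}|^\alpha|a_{j,j}|^{1-\alpha}>[\alpha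 g_i+(1-\alpha)h_j]^\beta[\alpha h_i+(1-\alpha)g_j]^{1-\beta}$; 8. $|a_{i,i}|^\alpha|a_{j,j}|^{1-\alpha}>[\alpha g_i+(1-\alpha)g_j]^\beta[\alpha h_i+(1-\alpha)h_j]^{1-\beta}$. **Theorem 4.5 (specialisation).** $A\in GDD$ provided there exist $X,Y\in D_n^P$ and $\alpha,\beta\in[0,1]$ such that, with $(g,h)$ replaced by $(\tilde r^X,\tilde c^Y)$, one of the conditions 1–8, or the condition $|a_{i,i}|^\alpha|a_{j,j}|^{1-\alpha}>\alpha h_i+(1-\alpha)h_j$, holds for all $i\neq j$. The same is true with $(g,h)$ replaced by $(r^X,c^Y)$. -/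

import Mathlib

namespace GFun

/-- Complex square matrices of order `n`. -/
abbrev Mat (n : ℕ) := Matrix (Fin n) (Fin n) ℂ

/-- The deleted absolute row sum `r_i(A)`. -/
noncomputable def r {n : ℕ} (A : Mat n) (i : Fin n) : ℝ :=
  ∑ j ∈ Finset.univ.erase i, ‖A i j‖

/-- The deleted absolute column sum `c_i(A)`. -/
noncomputable def c {n : ℕ} (A : Mat n) (i : Fin n) : ℝ :=
  ∑ j ∈ Finset.univ.erase i, ‖A j i‖

/-- Strict diagonal dominance by rows. -/
def SDD {n : ℕ} (A : Mat n) : Prop :=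
  ∀ i, ‖A i i‖ > r A i

/-- `X⁻¹ A X` for the real diagonal matrix `X = diag (x_1, …, x_n)`; it is used only for vectors
`x` with positive entries. -/
noncomputable def conj {n : ℕ} (x : Fin n → ℝ) (A : Mat n) : Mat n :=
  Matrix.diagonal (fun i => ((x i : ℝ) : ℂ)⁻¹) * A * Matrix.diagonal (fun i => ((x i : ℝ) : ℂ))

/-- Generalized diagonal dominance: `X⁻¹ A X` is strictly diagonally dominant for some diagonal
matrix `X` with positive diagonal. -/
def GDD {n : ℕ} (A : Mat n) : Prop :=
  ∃ x : Fin n → ℝ, (∀ i, 0 < x i) ∧ SDD (conj x A)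

/-- The weighted row sums `r^X(A) = r(X⁻¹ A X)`. -/
noncomputable def rW {n : ℕ} (x : Fin n → ℝ) (A : Mat n) : Fin n → ℝ := r (conj x A)

/-- The weighted column sums `c^X(A) = c(X⁻¹ A X)`. -/
noncomputable def cW {n : ℕ} (x : Fin n → ℝ) (A : Mat n) : Fin n → ℝ := c (conj x A)

/-- The class `ℱ_n`: nonnegative vector-valued functions of a matrix that depend only on the moduli
of its off-diagonal entries. -/
def IsF (n : ℕ) (f : Mat n → Fin n → ℝ) : Prop :=
  (∀ A k, 0 ≤ f A k) ∧
    ∀ A B : Mat n, (∀ i j, i ≠ j → ‖A i j‖ = ‖B i j‖) → f A = f B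

/-- The set `𝒢_n` of `G`-functions. -/
def G (n : ℕ) : Set (Mat n → Fin n → ℝ) :=
  {f | IsF n f ∧ ∀ A : Mat n, (∀ i, ‖A i i‖ > f A i) → IsUnit A}

/-- `i` and `j` index the same diagonal block of the Frobenius normal form of `A`: each is reachable
from the other in the directed graph with an edge `k → l` whenever `A k l ≠ 0`
(see `sameBlock_iff_of_frobenius`). -/
def SameBlock {n : ℕ} (A : Mat n) (i j : Fin n) : Prop :=
  Relation.ReflTransGen (fun k l => A k l ≠ 0) i j ∧
    Relation.ReflTransGen (fun k l => A k l ≠ 0) j i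

/-- A Frobenius normal form of `A`, recorded by the number `b i` of the diagonal block in which the
index `i` lies: the blocks below the block diagonal vanish, and every diagonal block is irreducible,
i.e. it has no nonempty proper set `S` of indices with zero entries in the columns of `S` and the
rows outside `S` (this holds automatically for blocks of order one). -/
def IsFrobenius {n : ℕ} (A : Mat n) (b : Fin n → ℕ) : Prop :=
  (∀ i j, b j < b i → A i j = 0) ∧
    ∀ k, ¬ ∃ S : Set (Fin n), S.Nonempty ∧ S ⊂ {i | b i = k} ∧
      ∀ i j, b i = k → i ∉ S → j ∈ S → A i j = 0

/-- The blocks described by `SameBlock` are those of any Frobenius normal form. -/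
theorem sameBlock_iff_of_frobenius {n : ℕ} (A : Mat n) (b : Fin n → ℕ) (hb : IsFrobenius A b)
    (i j : Fin n) : SameBlock A i j ↔ b i = b j := by
  have mono : ∀ p q, Relation.ReflTransGen (fun k l => A k l ≠ 0) p q → b p ≤ b q := by
    intro p q h
    induction h with
    | refl => exact le_rfl
    | tail _ h2 ih =>
      refine ih.trans ?_
      by_contra hlt
      exact h2 (hb.1 _ _ (not_le.mp hlt))
  have conn : ∀ p q, b p = b q → Relation.ReflTransGen (fun k l => A k l ≠ 0) p q := by
    intro p q hpq
    by_contra hn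
    refine hb.2 (b q) ⟨{m | b m = b q ∧ Relation.ReflTransGen (fun k l => A k l ≠ 0) m q},
      ⟨q, rfl, .refl⟩, ⟨fun m hm => hm.1, fun h => hn (h hpq).2⟩, ?_⟩
    intro m l hm hmS hl
    by_contra hml
    exact hmS ⟨hm, .head hml hl.2⟩
  exact ⟨fun h => le_antisymm (mono _ _ h.1) (mono _ _ h.2),
    fun h => ⟨conn _ _ h, conn _ _ h.symm⟩⟩

open Classical in
/-- `r̃_i(A)`: the deleted absolute row sum within the diagonal block of the Frobenius normal form
that contains `i`. -/
noncomputable def rT {n : ℕ} (A : Mat n) (i : Fin n) : ℝ :=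
  ∑ j ∈ Finset.univ.filter (fun j => j ≠ i ∧ SameBlock A i j), ‖A i j‖

open Classical in
/-- `c̃_i(A)`: the deleted absolute column sum within the diagonal block of the Frobenius normal form
that contains `i`. -/
noncomputable def cT {n : ℕ} (A : Mat n) (i : Fin n) : ℝ :=
  ∑ j ∈ Finset.univ.filter (fun j => j ≠ i ∧ SameBlock A i j), ‖A j i‖

/-- `r̃^X(A) = r̃(X⁻¹ A X)`. -/
noncomputable def rTW {n : ℕ} (x : Fin n → ℝ) (A : Mat n) : Fin n → ℝ := rT (conj x A)

/-- `c̃^X(A) = c̃(X⁻¹ A X)`. -/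
noncomputable def cTW {n : ℕ} (x : Fin n → ℝ) (A : Mat n) : Fin n → ℝ := cT (conj x A)

/-- One of the eight mixed inequalities holds for all `i ≠ j`; here `d i` stands for `|a_ii|`, and
`u`, `v` for the values `g(A)`, `h(A)`. -/
def Mixed {n : ℕ} (d u v : Fin n → ℝ) (α β : ℝ) : Prop :=
  (∀ i j, i ≠ j → d i * d j >
      (α * u i + (1 - α) * v j) * (α * u j + (1 - α) * v i)) ∨
  (∀ i j, i ≠ j → d i * d j >
      (α * u i + (1 - α) * u j) * (α * v j + (1 - α) * v i)) ∨
  (∀ i j, i ≠ j → d i ^ α * d j ^ (1 - α) > α * u i + (1 - α) * u j) ∨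
  (∀ i j, i ≠ j → d i ^ α * d j ^ (1 - α) > α * u i + (1 - α) * v j) ∨
  (∀ i j, i ≠ j → d i ^ α * d j ^ (1 - α) >
      α * (u i ^ β * v i ^ (1 - β)) + (1 - α) * (u j ^ β * v j ^ (1 - β))) ∨
  (∀ i j, i ≠ j → d i ^ α * d j ^ (1 - α) >
      α * (u i ^ β * v i ^ (1 - β)) + (1 - α) * (v j ^ β * u j ^ (1 - β))) ∨
  (∀ i j, i ≠ j → d i ^ α * d j ^ (1 - α) >
      (α * u i + (1 - α) * v j) ^ β * (α * v i + (1 - α) * u j) ^ (1 - β)) ∨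
  (∀ i j, i ≠ j → d i ^ α * d j ^ (1 - α) >
      (α * u i + (1 - α) * u j) ^ β * (α * v i + (1 - α) * v j) ^ (1 - β))

end GFun

namespace GFun

/-! Call `f` dominating for `A` if some positive vector x satisfies ∑_{j≠i} |a_ij| x_j < f_i x_i for
every i; then `GDD` is domination by the moduli of the diagonal. Each of g, h, r̃^X, c̃^Y dominates
after adding any ε > 0. For G-functions this is M-matrix theory: the comparison matrix stays
nonsingular as its diagonal grows (`dom_of_det_ne_zero`). For r̃ explicit weights make the entries
outside the blocks negligible (`nearDom_rT`), and columns follow by transposition.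

Dominating vectors are closed under weighted geometric means (`Dom.geom_mean`), and a dominating f
may be replaced by d once f_i f_j < d_i d_j for all i ≠ j (`Dom.of_mul_lt_mul`). Hence an
Ostrowski-type inequality between u_i^γ v_i^(1-γ) and the diagonal suffices (`gdd_of_geom_mean`).
Every mixed condition implies one: bound its right side below by AM-GM and, where it is not
symmetric, multiply the instances (i, j) and (j, i) (`Mixed.exists_geom_mean`). -/

open Finset

/-! ### Domination by positive weights -/

/-- Positive weights `x` make row `i` of `A` strictly dominated by `f i`, for every `i`. -/
def Dom {n : ℕ} (A : Mat n) (f : Fin n → ℝ) : Prop :=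
  ∃ x : Fin n → ℝ, (∀ i, 0 < x i) ∧ ∀ i, ∑ j ∈ univ.erase i, ‖A i j‖ * x j < f i * x i

/-- Every positive increase of `f` dominates `A`. -/
def NearDom {n : ℕ} (A : Mat n) (f : Fin n → ℝ) : Prop :=
  ∀ ε > 0, Dom A (fun i => f i + ε)

theorem norm_conj {n : ℕ} {x : Fin n → ℝ} (hx : ∀ i, 0 < x i) (A : Mat n) (i j : Fin n) :
    ‖conj x A i j‖ = (x i)⁻¹ * ‖A i j‖ * x j := by
  simp [conj, Matrix.diagonal_mul, Matrix.mul_diagonal, abs_of_pos (hx _)]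

theorem Dom.pos {n : ℕ} {A : Mat n} {f : Fin n → ℝ} (h : Dom A f) (i : Fin n) : 0 < f i := by
  obtain ⟨x, hx, h⟩ := h
  have h0 : 0 ≤ ∑ j ∈ univ.erase i, ‖A i j‖ * x j :=
    sum_nonneg fun j _ => mul_nonneg (norm_nonneg _) (hx j).le
  exact pos_of_mul_pos_left (h0.trans_lt (h i)) (hx i).le

theorem Dom.mono {n : ℕ} {A : Mat n} {f f' : Fin n → ℝ} (h : Dom A f) (hf : ∀ i, f i ≤ f' i) :
    Dom A f' := by
  obtain ⟨x, hx, h⟩ := h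
  exact ⟨x, hx, fun i => (h i).trans_le (mul_le_mul_of_nonneg_right (hf i) (hx i).le)⟩

theorem NearDom.mono {n : ℕ} {A : Mat n} {f f' : Fin n → ℝ} (h : NearDom A f)
    (hf : ∀ i, f i ≤ f' i) : NearDom A f' :=
  fun ε hε => (h ε hε).mono fun i => by linarith [hf i]

theorem Dom.of_conj {n : ℕ} {A : Mat n} {x : Fin n → ℝ} (hx : ∀ i, 0 < x i) {f : Fin n → ℝ}
    (h : Dom (conj x A) f) : Dom A f := by
  obtain ⟨y, hy, h⟩ := h
  refine ⟨fun i => x i * y i, fun i => mul_pos (hx i) (hy i), fun i => ?_⟩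
  have e : ∑ j ∈ univ.erase i, ‖A i j‖ * (x j * y j) =
      x i * ∑ j ∈ univ.erase i, ‖conj x A i j‖ * y j := by
    rw [mul_sum]
    refine sum_congr rfl fun j _ => ?_
    have := (hx i).ne'
    rw [norm_conj hx]
    field_simp
  rw [e]
  calc _ < x i * (f i * y i) := mul_lt_mul_of_pos_left (h i) (hx i)
    _ = _ := by ring

theorem gdd_of_dom {n : ℕ} {A : Mat n} (h : Dom A fun i => ‖A i i‖) : GDD A := by
  obtain ⟨x, hx, h⟩ := h
  refine ⟨x, hx, fun i => ?_⟩
  have hi := (hx i).ne'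
  have e : r (conj x A) i = (x i)⁻¹ * ∑ j ∈ univ.erase i, ‖A i j‖ * x j := by
    rw [r, mul_sum]
    exact sum_congr rfl fun j _ => by rw [norm_conj hx, mul_assoc]
  rw [e, norm_conj hx, gt_iff_lt, mul_assoc]
  exact mul_lt_mul_of_pos_left (h i) (inv_pos.2 (hx i))

/-! ### Comparison matrices and G-functions -/

/-- The real matrix with diagonal `d` and off-diagonal entries `-|a_ij|`. -/
noncomputable def comparison {n : ℕ} (A : Mat n) (d : Fin n → ℝ) : Matrix (Fin n) (Fin n) ℝ :=
  fun i j => if i = j then d i else -‖A i j‖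

theorem comparison_mulVec {n : ℕ} (A : Mat n) (d x : Fin n → ℝ) (i : Fin n) :
    (comparison A d).mulVec x i = d i * x i - ∑ j ∈ univ.erase i, ‖A i j‖ * x j := by
  rw [Matrix.mulVec, dotProduct, ← add_sum_erase _ _ (mem_univ i), sub_eq_add_neg,
    ← sum_neg_distrib]
  congr 1
  · simp [comparison]
  · refine sum_congr rfl fun j hj => ?_
    simp [comparison, (ne_of_mem_erase hj).symm]

/-- Scaling the columns by the weights gives a strictly diagonally dominant matrix. -/
theorem Dom.det_ne_zero {n : ℕ} {A : Mat n} {d : Fin n → ℝ} (h : Dom A d) :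
    (comparison A d).det ≠ 0 := by
  have hd := h.pos
  obtain ⟨x, hx, h⟩ := h
  have : (comparison A d * Matrix.diagonal x).det ≠ 0 := by
    refine det_ne_zero_of_sum_row_lt_diag fun i => ?_
    have e : ∑ j ∈ univ.erase i, ‖(comparison A d * Matrix.diagonal x) i j‖ =
        ∑ j ∈ univ.erase i, ‖A i j‖ * x j := by
      refine sum_congr rfl fun j hj => ?_
      simp [comparison, (ne_of_mem_erase hj).symm, abs_of_pos (hx _)]
    rw [e]
    simpa [comparison, abs_of_pos (hx _), abs_of_pos (hd _)] using h i
  rw [Matrix.det_mul] at this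
  exact left_ne_zero_of_mul this

/-- If the comparison matrix stays nonsingular when its diagonal increases uniformly, then it maps
some positive vector to a positive vector. -/
theorem dom_of_det_ne_zero {n : ℕ} (A : Mat n) (d : Fin n → ℝ) (hd : ∀ i, 0 < d i)
    (h : ∀ s : ℝ, 0 ≤ s → (comparison A fun i => d i + s).det ≠ 0) : Dom A d := by
  rcases isEmpty_or_nonempty (Fin n) with _ | _
  · exact ⟨fun _ => 1, isEmptyElim, isEmptyElim⟩
  set M : ℝ → Matrix (Fin n) (Fin n) ℝ := fun s => comparison A fun i => d i + s with hM
  set x : ℝ → Fin n → ℝ := fun s => (M s)⁻¹.mulVec 1 with hxdef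
  have hMx : ∀ s, 0 ≤ s → ∀ i,
      (d i + s) * x s i = 1 + ∑ j ∈ univ.erase i, ‖A i j‖ * x s j := by
    intro s hs i
    have e : (M s).mulVec (x s) i = 1 := by
      rw [hxdef, Matrix.mulVec_mulVec, Matrix.mul_nonsing_inv _ (h s hs).isUnit,
        Matrix.one_mulVec, Pi.one_apply]
    rw [comparison_mulVec] at e
    linarith
  -- The constant 1 on the right of `hMx` makes any nonnegative solution strictly positive.
  have hpos : ∀ s, 0 ≤ s → (∀ i, 0 ≤ x s i) → ∀ i, 0 < x s i := by
    intro s hs hx i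
    have h0 : 0 ≤ ∑ j ∈ univ.erase i, ‖A i j‖ * x s j :=
      sum_nonneg fun j _ => mul_nonneg (norm_nonneg _) (hx j)
    have h1 := hMx s hs i
    have h2 : 0 < d i + s := by linarith [hd i]
    exact pos_of_mul_pos_right (by linarith : 0 < (d i + s) * x s i) h2.le
  have hcM : Continuous M := by
    refine continuous_matrix fun i j => ?_
    by_cases hij : i = j
    · simp only [hM, comparison, hij, if_true]; fun_prop
    · simp only [hM, comparison, hij, if_false]; fun_prop
  have hcx : ∀ i, ContinuousOn (fun s => x s i) (Set.Ici 0) := by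
    intro i
    have e : ∀ s, x s i = (M s).det⁻¹ * ((M s).adjugate.mulVec 1) i := by
      intro s
      simp [hxdef, Matrix.inv_def, Matrix.smul_mulVec]
    simp only [e]
    refine ContinuousOn.mul (hcM.matrix_det.continuousOn.inv₀ fun s hs => h s hs) ?_
    exact ((continuous_apply i).comp
      (hcM.matrix_adjugate.matrix_mulVec continuous_const)).continuousOn
  set S : ℝ := ∑ i, ∑ j ∈ univ.erase i, ‖A i j‖ with hS
  have hS0 : 0 ≤ S := sum_nonneg fun i _ => sum_nonneg fun j _ => norm_nonneg _
  set m : ℝ → ℝ := fun s => univ.inf' univ_nonempty fun i => x s i with hm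
  have hml : ∀ s i, m s ≤ x s i := fun s i => inf'_le _ (mem_univ i)
  have hmem : ∀ s, ∃ i, m s = x s i := fun s => by
    obtain ⟨i, -, hi⟩ := exists_mem_eq_inf' univ_nonempty fun i => x s i
    exact ⟨i, hi⟩
  -- At s = S the diagonal exceeds every row sum, so the row attaining a negative minimum would
  -- contradict `hMx`.
  have hmS : 0 ≤ m S := by
    by_contra! hneg
    obtain ⟨i, hi⟩ := hmem S
    have h1 := hMx S hS0 i
    have h2 : (∑ j ∈ univ.erase i, ‖A i j‖) * m S ≤ ∑ j ∈ univ.erase i, ‖A i j‖ * x S j := by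
      rw [sum_mul]
      exact sum_le_sum fun j _ => mul_le_mul_of_nonneg_left (hml S j) (norm_nonneg _)
    have h3 : ∑ j ∈ univ.erase i, ‖A i j‖ ≤ S :=
      single_le_sum (f := fun i => ∑ j ∈ univ.erase i, ‖A i j‖)
        (fun i _ => sum_nonneg fun j _ => norm_nonneg _) (mem_univ i)
    rw [← hi] at h1
    nlinarith [hd i]
  have hcm : ContinuousOn m (Set.Icc 0 S) :=
    (ContinuousOn.finset_inf'_apply univ_nonempty fun i _ => hcx i).mono Set.Icc_subset_Ici_self
  -- Otherwise the minimum would vanish at some s in [0, S], where the solution is nonnegative but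
  -- not positive, against `hpos`.
  have hm0 : 0 ≤ m 0 := by
    by_contra! hneg
    obtain ⟨s, hs, hs0⟩ := intermediate_value_Icc hS0 hcm ⟨hneg.le, hmS⟩
    obtain ⟨i, hi⟩ := hmem s
    have := hpos s hs.1 (fun j => hs0 ▸ hml s j) i
    linarith
  refine ⟨x 0, hpos 0 le_rfl fun i => hm0.trans (hml 0 i), fun i => ?_⟩
  have := hMx 0 le_rfl i
  rw [add_zero] at this
  linarith

/-- The determinant criterion for domination is invariant under transposition, although the weights
are not. -/
theorem Dom.of_transpose {n : ℕ} {A : Mat n} {d : Fin n → ℝ} (h : Dom A.transpose d) :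
    Dom A d := by
  refine dom_of_det_ne_zero A d h.pos fun s hs => ?_
  rw [← Matrix.det_transpose]
  have e : (comparison A fun i => d i + s).transpose =
      comparison A.transpose fun i => d i + s := by
    ext i j
    by_cases hij : i = j
    · simp [comparison, hij]
    · simp [comparison, hij, Ne.symm hij]
  rw [e]
  exact (h.mono fun i => by linarith).det_ne_zero

/-- The comparison matrix has the off-diagonal moduli of `A`, hence the same value of g, and its
diagonal exceeds that value. -/
theorem nearDom_of_mem_G {n : ℕ} {g : Mat n → Fin n → ℝ} (hg : g ∈ G n) (A : Mat n) :
    NearDom A (g A) := by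
  obtain ⟨⟨hg0, hgc⟩, hgu⟩ := hg
  intro ε hε
  refine dom_of_det_ne_zero A _ (fun i => by linarith [hg0 A i]) fun s hs => ?_
  set B := comparison A fun i => g A i + ε + s with hB
  have hAB : g (B.map Complex.ofRealHom) = g A :=
    hgc _ _ fun i j hij => by simp [hB, comparison, hij]
  have hu := hgu (B.map Complex.ofRealHom) fun i => by
    have h0 := hg0 A i
    have e : ‖B.map Complex.ofRealHom i i‖ = g A i + ε + s := by
      simp only [hB, comparison, Matrix.map_apply, if_true, Complex.ofRealHom_eq_coe,
        Complex.norm_real, Real.norm_eq_abs]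
      exact abs_of_nonneg (by linarith)
    rw [hAB, e]
    linarith
  rw [Matrix.isUnit_iff_isUnit_det] at hu
  intro h0
  have := Complex.ofRealHom.map_det B
  rw [h0, map_zero] at this
  exact hu.ne_zero this.symm

/-! ### Row and column sums within Frobenius blocks -/

theorem sameBlock_transpose {n : ℕ} (A : Mat n) (i j : Fin n) :
    SameBlock A.transpose i j ↔ SameBlock A i j := by
  have e : ∀ k l, Relation.ReflTransGen (fun k l => A.transpose k l ≠ 0) k l ↔
      Relation.ReflTransGen (fun k l => A k l ≠ 0) l k := fun _ _ => Relation.reflTransGen_swap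
  rw [SameBlock, SameBlock, e, e, and_comm]

theorem rT_transpose {n : ℕ} (A : Mat n) : rT A.transpose = cT A := by
  ext i
  refine sum_congr ?_ fun j _ => rfl
  ext j
  simp only [mem_filter, sameBlock_transpose]

-- Weight i by a large K to the number of indices reachable from i. The weight is constant on blocks
-- and drops by a factor of at least K along an edge leaving a block.
open Classical in
theorem nearDom_rT {n : ℕ} (A : Mat n) : NearDom A (rT A) := by
  intro ε hε
  set R : Fin n → Finset (Fin n) :=
    fun i => univ.filter fun j => Relation.ReflTransGen (fun k l => A k l ≠ 0) i j with hR
  have hlt : ∀ i j, A i j ≠ 0 → ¬ SameBlock A i j → #(R j) < #(R i) := by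
    intro i j hij hb
    refine card_lt_card ⟨fun l hl => ?_, fun hs => hb ⟨.single hij, ?_⟩⟩
    · simp only [hR, mem_filter, mem_univ, true_and] at hl ⊢
      exact .head hij hl
    · have : i ∈ R i := by simp only [hR, mem_filter, mem_univ, true_and]; exact .refl
      simpa only [hR, mem_filter, mem_univ, true_and] using hs this
  have heq : ∀ i j, SameBlock A i j → #(R j) = #(R i) := by
    intro i j hij
    congr 1
    ext l
    simp only [hR, mem_filter, mem_univ, true_and]
    exact ⟨hij.1.trans, hij.2.trans⟩
  set S : ℝ := ∑ i, ∑ j, ‖A i j‖ with hS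
  have hS0 : 0 ≤ S := sum_nonneg fun i _ => sum_nonneg fun j _ => norm_nonneg _
  -- Chosen so that S / K < ε: the terms outside the block sum to at most S / K times the weight of
  -- i.
  set K : ℝ := S / ε + 1 with hK
  have hK1 : 1 ≤ K := by have := div_nonneg hS0 hε.le; linarith
  have hK0 : 0 < K := by linarith
  have hSK : S < ε * K := by
    rw [hK, mul_add, mul_div_cancel₀ _ hε.ne']; linarith
  refine ⟨fun i => K ^ #(R i), fun i => pow_pos hK0 _, fun i => ?_⟩
  have hterm : ∀ j ∈ univ.erase i, ‖A i j‖ * K ^ #(R j) ≤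
      (if j ≠ i ∧ SameBlock A i j then ‖A i j‖ else 0) * K ^ #(R i) +
        ‖A i j‖ * (K ^ #(R i) / K) := by
    intro j hj
    have hji := ne_of_mem_erase hj
    have hp : 0 ≤ ‖A i j‖ * (K ^ #(R i) / K) := by positivity
    by_cases hb : SameBlock A i j
    · rw [if_pos ⟨hji, hb⟩, heq i j hb]; linarith
    · rw [if_neg fun h => hb h.2, zero_mul, zero_add]
      by_cases h0 : A i j = 0
      · simp [h0]
      · refine mul_le_mul_of_nonneg_left ?_ (norm_nonneg _)
        rw [le_div_iff₀ hK0, ← pow_succ]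
        exact pow_le_pow_right₀ hK1 (hlt i j h0 hb)
  have hsum := sum_le_sum hterm
  rw [sum_add_distrib, ← sum_mul, ← sum_mul] at hsum
  have e1 : ∑ j ∈ univ.erase i, (if j ≠ i ∧ SameBlock A i j then ‖A i j‖ else 0) = rT A i := by
    rw [rT, sum_filter, sum_erase]
    simp
  have e2 : ∑ j ∈ univ.erase i, ‖A i j‖ ≤ S :=
    (sum_le_sum_of_subset_of_nonneg (erase_subset _ _) fun _ _ _ => norm_nonneg _).trans
      (single_le_sum (f := fun i => ∑ j, ‖A i j‖)
        (fun i _ => sum_nonneg fun j _ => norm_nonneg _) (mem_univ i))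
  rw [e1] at hsum
  have hq : 0 < K ^ #(R i) / K := by positivity
  have e3 : K ^ #(R i) = K * (K ^ #(R i) / K) := by field_simp
  have : S * (K ^ #(R i) / K) < ε * K ^ #(R i) := by
    calc _ < ε * K * (K ^ #(R i) / K) := mul_lt_mul_of_pos_right hSK hq
      _ = _ := by rw [mul_assoc, ← e3]
  have h5 := mul_le_mul_of_nonneg_right e2 hq.le
  linarith

theorem nearDom_cT {n : ℕ} (A : Mat n) : NearDom A (cT A) := by
  intro ε hε
  have := nearDom_rT A.transpose ε hε
  rw [rT_transpose] at this
  exact this.of_transpose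

theorem nearDom_rTW {n : ℕ} (A : Mat n) {x : Fin n → ℝ} (hx : ∀ i, 0 < x i) :
    NearDom A (rTW x A) :=
  fun ε hε => (nearDom_rT (conj x A) ε hε).of_conj hx

theorem nearDom_cTW {n : ℕ} (A : Mat n) {x : Fin n → ℝ} (hx : ∀ i, 0 < x i) :
    NearDom A (cTW x A) :=
  fun ε hε => (nearDom_cT (conj x A) ε hε).of_conj hx

theorem rT_nonneg {n : ℕ} (A : Mat n) (i : Fin n) : 0 ≤ rT A i :=
  sum_nonneg fun _ _ => norm_nonneg _

theorem cT_nonneg {n : ℕ} (A : Mat n) (i : Fin n) : 0 ≤ cT A i :=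
  sum_nonneg fun _ _ => norm_nonneg _

theorem rT_le_r {n : ℕ} (A : Mat n) (i : Fin n) : rT A i ≤ r A i :=
  sum_le_sum_of_subset_of_nonneg (fun j hj => by simp_all) fun _ _ _ => norm_nonneg _

theorem cT_le_c {n : ℕ} (A : Mat n) (i : Fin n) : cT A i ≤ c A i :=
  sum_le_sum_of_subset_of_nonneg (fun j hj => by simp_all) fun _ _ _ => norm_nonneg _

/-! ### Geometric means and products over pairs -/

/-- This is Hölder's inequality: take geometric means of the weights, normalise each row, and apply
AM-GM termwise. -/
theorem Dom.geom_mean {n : ℕ} {A : Mat n} {p q : Fin n → ℝ} (hp : Dom A p) (hq : Dom A q)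
    {γ : ℝ} (h0 : 0 ≤ γ) (h1 : γ ≤ 1) : Dom A fun i => p i ^ γ * q i ^ (1 - γ) := by
  have hpp := hp.pos
  have hqp := hq.pos
  obtain ⟨x, hx, hp⟩ := hp
  obtain ⟨y, hy, hq⟩ := hq
  refine ⟨fun i => x i ^ γ * y i ^ (1 - γ), fun i =>
    mul_pos (Real.rpow_pos_of_pos (hx i) _) (Real.rpow_pos_of_pos (hy i) _), fun i => ?_⟩
  have hP : 0 < p i * x i := mul_pos (hpp i) (hx i)
  have hQ : 0 < q i * y i := mul_pos (hqp i) (hy i)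
  have hC : 0 < (p i * x i) ^ γ * (q i * y i) ^ (1 - γ) :=
    mul_pos (Real.rpow_pos_of_pos hP _) (Real.rpow_pos_of_pos hQ _)
  have eC : p i ^ γ * q i ^ (1 - γ) * (x i ^ γ * y i ^ (1 - γ)) =
      (p i * x i) ^ γ * (q i * y i) ^ (1 - γ) := by
    rw [Real.mul_rpow (hpp i).le (hx i).le, Real.mul_rpow (hqp i).le (hy i).le]
    ring
  rw [eC]
  have hterm : ∀ j ∈ univ.erase i, ‖A i j‖ * (x j ^ γ * y j ^ (1 - γ)) ≤
      (γ * ((‖A i j‖ * x j) / (p i * x i)) + (1 - γ) * ((‖A i j‖ * y j) / (q i * y i))) *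
        ((p i * x i) ^ γ * (q i * y i) ^ (1 - γ)) := by
    intro j _
    have am := Real.geom_mean_le_arith_mean2_weighted h0 (sub_nonneg.2 h1)
      (div_nonneg (hx j).le hP.le) (div_nonneg (hy j).le hQ.le) (by ring)
    rw [Real.div_rpow (hx j).le hP.le, Real.div_rpow (hy j).le hQ.le, div_mul_div_comm,
      div_le_iff₀ hC] at am
    calc _ ≤ _ := mul_le_mul_of_nonneg_left am (norm_nonneg (A i j))
      _ = _ := by ring
  refine (sum_le_sum hterm).trans_lt ?_
  rw [← sum_mul, sum_add_distrib, ← mul_sum, ← mul_sum, ← sum_div, ← sum_div]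
  have a1 := (div_lt_one hP).2 (hp i)
  have a2 := (div_lt_one hQ).2 (hq i)
  refine mul_lt_of_lt_one_left hC ?_
  rcases h0.eq_or_lt with rfl | h0
  · linarith
  · nlinarith

/-- If f_k > d_k, enlarge the weight of k by t = f_k / d_k. Row k keeps its sum and now needs only
d_k; any other row sum grows at most by t, and t f_i < d_i by the pair inequality. -/
theorem Dom.of_mul_lt_mul {n : ℕ} (hn : 2 ≤ n) {A : Mat n} {f d : Fin n → ℝ} (hf : Dom A f)
    (hd0 : ∀ i, 0 ≤ d i) (h : ∀ i j, i ≠ j → f i * f j < d i * d j) : Dom A d := by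
  by_cases hk : ∀ i, f i ≤ d i
  · exact hf.mono hk
  push Not at hk
  obtain ⟨k, hk⟩ := hk
  have hfp := hf.pos
  have hdk : 0 < d k := by
    have : Nontrivial (Fin n) := Fin.nontrivial_iff_two_le.2 hn
    obtain ⟨j, hj⟩ := exists_ne k
    exact pos_of_mul_pos_left ((mul_pos (hfp k) (hfp j)).trans (h k j hj.symm)) (hd0 j)
  obtain ⟨x, hx, hf⟩ := hf
  set t := f k / d k with ht
  have ht1 : 1 ≤ t := (one_le_div hdk).2 hk.le
  have ht0 : 0 < t := by linarith
  refine ⟨fun i => (if i = k then t else 1) * x i, fun i => mul_pos (by split_ifs <;> linarith)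
    (hx i), fun i => ?_⟩
  by_cases hi : i = k
  · subst hi
    have e : ∑ j ∈ univ.erase i, ‖A i j‖ * ((if j = i then t else 1) * x j) =
        ∑ j ∈ univ.erase i, ‖A i j‖ * x j :=
      sum_congr rfl fun j hj => by rw [if_neg (ne_of_mem_erase hj), one_mul]
    simp only [e, if_true]
    rw [← mul_assoc, ht, mul_div_cancel₀ _ hdk.ne']
    exact hf i
  · have e : ∑ j ∈ univ.erase i, ‖A i j‖ * ((if j = k then t else 1) * x j) ≤
        t * ∑ j ∈ univ.erase i, ‖A i j‖ * x j := by
      rw [mul_sum]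
      refine sum_le_sum fun j _ => ?_
      have : (if j = k then t else 1) ≤ t := by split_ifs <;> linarith
      have h2 := mul_le_mul_of_nonneg_right this (mul_nonneg (norm_nonneg (A i j)) (hx j).le)
      linarith
    refine e.trans_lt ?_
    simp only [hi, if_false, one_mul]
    have h3 : t * f i < d i := by
      rw [ht, div_mul_eq_mul_div, div_lt_iff₀ hdk]
      linarith [h i k hi]
    calc _ < t * (f i * x i) := mul_lt_mul_of_pos_left (hf i) ht0
      _ = t * f i * x i := by ring
      _ < _ := mul_lt_mul_of_pos_right h3 (hx i)

theorem gdd_of_geom_mean {n : ℕ} (hn : 2 ≤ n) {A : Mat n} {u v : Fin n → ℝ} (hu : NearDom A u)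
    (hv : NearDom A v) {γ : ℝ} (h0 : 0 ≤ γ) (h1 : γ ≤ 1)
    (h : ∀ i j, i ≠ j →
      (u i ^ γ * v i ^ (1 - γ)) * (u j ^ γ * v j ^ (1 - γ)) < ‖A i i‖ * ‖A j j‖) : GDD A := by
  -- Fixed nonnegative exponents keep the powers continuous at base 0, so the finitely many strict
  -- inequalities survive a small ε.
  have hc : ∀ i, Continuous fun ε : ℝ => (u i + ε) ^ γ * (v i + ε) ^ (1 - γ) := fun i =>
    ((continuous_const.add continuous_id).rpow_const fun _ => .inr h0).mul
      ((continuous_const.add continuous_id).rpow_const fun _ => .inr (sub_nonneg.2 h1))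
  have hev : ∀ᶠ ε in nhdsWithin (0 : ℝ) (Set.Ioi 0), ∀ i j, i ≠ j →
      ((u i + ε) ^ γ * (v i + ε) ^ (1 - γ)) * ((u j + ε) ^ γ * (v j + ε) ^ (1 - γ)) <
        ‖A i i‖ * ‖A j j‖ := by
    rw [Filter.eventually_all]
    intro i
    rw [Filter.eventually_all]
    intro j
    by_cases hij : i = j
    · simp [hij]
    · refine Filter.Eventually.filter_mono nhdsWithin_le_nhds ?_
      have := ((hc i).mul (hc j)).continuousAt (x := 0) |>.eventually_lt_const
        (u := ‖A i i‖ * ‖A j j‖) (by simpa using h i j hij)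
      exact this.mono fun ε hε _ => hε
  obtain ⟨ε, hε, hpos⟩ := (hev.and self_mem_nhdsWithin).exists
  exact gdd_of_dom <| ((hu ε hpos).geom_mean (hv ε hpos) h0 h1).of_mul_lt_mul hn
    (fun i => norm_nonneg _) hε

/-! ### Reduction of the mixed inequalities -/

theorem mul_lt_mul_of_rpow_mul_rpow {α a b p R R' : ℝ} (h0 : 0 ≤ α) (h1 : α ≤ 1) (ha : 0 ≤ a)
    (hb : 0 ≤ b) (hR : 0 ≤ R) (hR' : 0 ≤ R') (h : R < a ^ α * b ^ (1 - α))
    (h' : R' < b ^ α * a ^ (1 - α)) (hp : p ≤ R * R') : p < a * b := by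
  have ea : a ^ α * a ^ (1 - α) = a := by
    rw [← Real.rpow_add_of_nonneg ha h0 (sub_nonneg.2 h1)]; simp
  have eb : b ^ α * b ^ (1 - α) = b := by
    rw [← Real.rpow_add_of_nonneg hb h0 (sub_nonneg.2 h1)]; simp
  calc p ≤ R * R' := hp
    _ < (a ^ α * b ^ (1 - α)) * (b ^ α * a ^ (1 - α)) := mul_lt_mul'' h h' hR hR'
    _ = (a ^ α * a ^ (1 - α)) * (b ^ α * b ^ (1 - α)) := by ring
    _ = a * b := by rw [ea, eb]

/-- Each of the mixed inequalities implies an inequality of Ostrowski type. -/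
theorem Mixed.exists_geom_mean {n : ℕ} {d u v : Fin n → ℝ} {α β : ℝ} (hd : ∀ i, 0 ≤ d i)
    (hu : ∀ i, 0 ≤ u i) (hv : ∀ i, 0 ≤ v i) (hα : α ∈ Set.Icc (0 : ℝ) 1)
    (hβ : β ∈ Set.Icc (0 : ℝ) 1) (h : Mixed d u v α β) :
    ∃ γ ∈ Set.Icc (0 : ℝ) 1, ∀ i j, i ≠ j →
      (u i ^ γ * v i ^ (1 - γ)) * (u j ^ γ * v j ^ (1 - γ)) < d i * d j := by
  obtain ⟨a0, a1⟩ := hα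
  obtain ⟨b0, b1⟩ := hβ
  have a1' : 0 ≤ 1 - α := sub_nonneg.2 a1
  have b1' : 0 ≤ 1 - β := sub_nonneg.2 b1
  have am : ∀ {a b : ℝ}, 0 ≤ a → 0 ≤ b → a ^ α * b ^ (1 - α) ≤ α * a + (1 - α) * b :=
    fun ha hb => Real.geom_mean_le_arith_mean2_weighted a0 a1' ha hb (by ring)
  have P : ∀ {a : ℝ} (γ : ℝ), 0 ≤ a → 0 ≤ a ^ γ := fun γ ha => Real.rpow_nonneg ha γ
  have add : ∀ {a s t : ℝ}, 0 ≤ a → 0 ≤ s → 0 ≤ t → a ^ (s + t) = a ^ s * a ^ t :=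
    fun ha hs ht => Real.rpow_add_of_nonneg ha hs ht
  have one : ∀ {a : ℝ}, 0 ≤ a → a ^ α * a ^ (1 - α) = a := fun ha => by
    rw [← add ha a0 a1']; simp
  have aff : ∀ {a b : ℝ}, 0 ≤ a → 0 ≤ b → 0 ≤ α * a + (1 - α) * b := fun ha hb =>
    add_nonneg (mul_nonneg a0 ha) (mul_nonneg a1' hb)
  have gm : ∀ {a b : ℝ}, 0 ≤ a → 0 ≤ b → 0 ≤ a ^ α * b ^ (1 - α) := fun ha hb =>
    mul_nonneg (P _ ha) (P _ hb)
  have gb : ∀ {a b : ℝ}, 0 ≤ a → 0 ≤ b → 0 ≤ a ^ β * b ^ (1 - β) := fun ha hb =>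
    mul_nonneg (P _ ha) (P _ hb)
  have gbm : ∀ {a b a' b' : ℝ}, 0 ≤ a → 0 ≤ b → a ≤ a' → b ≤ b' →
      a ^ β * b ^ (1 - β) ≤ a' ^ β * b' ^ (1 - β) := fun ha hb h h' =>
    mul_le_mul (Real.rpow_le_rpow ha h b0) (Real.rpow_le_rpow hb h' b1') (P _ hb)
      (P _ (ha.trans h))
  have dist : ∀ {a b : ℝ} (γ : ℝ), 0 ≤ a → 0 ≤ b →
      (a ^ α * b ^ (1 - α)) ^ γ = (a ^ α) ^ γ * (b ^ (1 - α)) ^ γ := fun γ ha hb =>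
    Real.mul_rpow (P _ ha) (P _ hb)
  have distb : ∀ {a b : ℝ} (γ : ℝ), 0 ≤ a → 0 ≤ b →
      (a ^ β * b ^ (1 - β)) ^ γ = (a ^ β) ^ γ * (b ^ (1 - β)) ^ γ := fun γ ha hb =>
    Real.mul_rpow (P _ ha) (P _ hb)
  have comm : ∀ {a : ℝ} (s t : ℝ), 0 ≤ a → (a ^ s) ^ t = (a ^ t) ^ s := fun s t ha => by
    rw [← Real.rpow_mul ha, ← Real.rpow_mul ha, mul_comm]
  -- The total exponent of u_i in conditions 6 and 7: αβ from the pair (i, j) and (1-α)(1-β) from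
  -- (j, i).
  set δ := α * β + (1 - α) * (1 - β) with hδ
  have d0 : δ ∈ Set.Icc (0 : ℝ) 1 := by
    constructor <;> nlinarith [mul_nonneg a0 b0, mul_nonneg a1' b1', mul_nonneg a0 b1',
      mul_nonneg a1' b0]
  have eδ : ∀ {a : ℝ}, 0 ≤ a → a ^ δ = (a ^ α) ^ β * (a ^ (1 - α)) ^ (1 - β) := fun ha => by
    rw [hδ, add ha (mul_nonneg a0 b0) (mul_nonneg a1' b1'), Real.rpow_mul ha, Real.rpow_mul ha]
  have eδ' : ∀ {a : ℝ}, 0 ≤ a → a ^ (1 - δ) = (a ^ α) ^ (1 - β) * (a ^ (1 - α)) ^ β := fun ha => by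
    rw [show 1 - δ = α * (1 - β) + (1 - α) * β by rw [hδ]; ring,
      add ha (mul_nonneg a0 b1') (mul_nonneg a1' b0), Real.rpow_mul ha, Real.rpow_mul ha]
  rcases h with h | h | h | h | h | h | h | h
  · refine ⟨α, ⟨a0, a1⟩, fun i j hij => lt_of_le_of_lt ?_ (h i j hij)⟩
    calc _ = (u i ^ α * v j ^ (1 - α)) * (u j ^ α * v i ^ (1 - α)) := by ring
      _ ≤ _ := mul_le_mul (am (hu i) (hv j)) (am (hu j) (hv i)) (gm (hu j) (hv i))
        (aff (hu i) (hv j))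
  -- The two orders multiply to u_i v_i u_j v_j < (d_i d_j)^2; the square root gives γ = 1/2.
  · refine ⟨1 / 2, by norm_num, fun i j hij => ?_⟩
    have key : ∀ k l, k ≠ l → (u k ^ α * u l ^ (1 - α)) * (v l ^ α * v k ^ (1 - α)) < d k * d l :=
      fun k l hkl => lt_of_le_of_lt (mul_le_mul (am (hu k) (hu l)) (am (hv l) (hv k))
        (gm (hv l) (hv k)) (aff (hu k) (hu l))) (h k l hkl)
    have half : ∀ {a : ℝ}, 0 ≤ a → a ^ (1 / 2 : ℝ) * a ^ (1 - 1 / 2 : ℝ) = a := fun ha => by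
      rw [← add ha (by norm_num) (by norm_num)]; norm_num
    have h1 := mul_lt_mul'' (key i j hij) (key j i hij.symm)
      (mul_nonneg (gm (hu i) (hu j)) (gm (hv j) (hv i)))
      (mul_nonneg (gm (hu j) (hu i)) (gm (hv i) (hv j)))
    have e1 : (u i ^ α * u j ^ (1 - α)) * (v j ^ α * v i ^ (1 - α)) *
        ((u j ^ α * u i ^ (1 - α)) * (v i ^ α * v j ^ (1 - α))) = (u i * v i) * (u j * v j) := by
      calc _ = (u i ^ α * u i ^ (1 - α)) * (v i ^ α * v i ^ (1 - α)) *
          ((u j ^ α * u j ^ (1 - α)) * (v j ^ α * v j ^ (1 - α))) := by ring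
        _ = _ := by rw [one (hu i), one (hv i), one (hu j), one (hv j)]
    rw [e1] at h1
    refine lt_of_pow_lt_pow_left₀ 2 (mul_nonneg (hd i) (hd j)) ?_
    have e2 : ∀ {a : ℝ}, 0 ≤ a → (a ^ (1 / 2 : ℝ)) ^ 2 = a := fun ha => by
      rw [← Real.rpow_natCast, ← Real.rpow_mul ha]; norm_num
    rw [show (1 - 1 / 2 : ℝ) = 1 / 2 by norm_num]
    simp only [mul_pow, e2 (hu i), e2 (hv i), e2 (hu j), e2 (hv j)]
    calc _ < _ := h1
      _ = _ := by ring
  · refine ⟨1, by norm_num, fun i j hij => mul_lt_mul_of_rpow_mul_rpow a0 a1 (hd i) (hd j)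
      (aff (hu i) (hu j)) (aff (hu j) (hu i)) (h i j hij) (h j i hij.symm) ?_⟩
    refine le_trans (le_of_eq ?_) (mul_le_mul (am (hu i) (hu j)) (am (hu j) (hu i))
      (gm (hu j) (hu i)) (aff (hu i) (hu j)))
    simp only [Real.rpow_one, sub_self, Real.rpow_zero, mul_one]
    calc _ = (u i ^ α * u i ^ (1 - α)) * (u j ^ α * u j ^ (1 - α)) := by
          rw [one (hu i), one (hu j)]
      _ = _ := by ring
  · refine ⟨α, ⟨a0, a1⟩, fun i j hij => mul_lt_mul_of_rpow_mul_rpow a0 a1 (hd i) (hd j)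
      (aff (hu i) (hv j)) (aff (hu j) (hv i)) (h i j hij) (h j i hij.symm) ?_⟩
    refine le_trans (le_of_eq ?_) (mul_le_mul (am (hu i) (hv j)) (am (hu j) (hv i))
      (gm (hu j) (hv i)) (aff (hu i) (hv j)))
    ring
  · refine ⟨β, ⟨b0, b1⟩, fun i j hij => mul_lt_mul_of_rpow_mul_rpow a0 a1 (hd i) (hd j)
      (aff (gb (hu i) (hv i)) (gb (hu j) (hv j))) (aff (gb (hu j) (hv j)) (gb (hu i) (hv i)))
      (h i j hij) (h j i hij.symm) ?_⟩
    have pi := gb (hu i) (hv i)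
    have pj := gb (hu j) (hv j)
    refine le_trans (le_of_eq ?_) (mul_le_mul (am pi pj) (am pj pi) (gm pj pi) (aff pi pj))
    generalize u i ^ β * v i ^ (1 - β) = a at *
    generalize u j ^ β * v j ^ (1 - β) = b at *
    calc a * b = (a ^ α * a ^ (1 - α)) * (b ^ α * b ^ (1 - α)) := by rw [one pi, one pj]
      _ = _ := by ring
  · refine ⟨δ, d0, fun i j hij => mul_lt_mul_of_rpow_mul_rpow a0 a1 (hd i) (hd j)
      (aff (gb (hu i) (hv i)) (gb (hv j) (hu j))) (aff (gb (hu j) (hv j)) (gb (hv i) (hu i)))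
      (h i j hij) (h j i hij.symm) ?_⟩
    refine le_trans (le_of_eq ?_) (mul_le_mul (am (gb (hu i) (hv i)) (gb (hv j) (hu j)))
      (am (gb (hu j) (hv j)) (gb (hv i) (hu i))) (gm (gb (hu j) (hv j)) (gb (hv i) (hu i)))
      (aff (gb (hu i) (hv i)) (gb (hv j) (hu j))))
    simp only [distb _ (hu _) (hv _), distb _ (hv _) (hu _), eδ (hu _), eδ' (hv _),
      comm α β (hu _), comm α (1 - β) (hv _), comm (1 - α) β (hv _),
      comm (1 - α) (1 - β) (hu _)]
    ring
  · refine ⟨δ, d0, fun i j hij => mul_lt_mul_of_rpow_mul_rpow a0 a1 (hd i) (hd j)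
      (gb (aff (hu i) (hv j)) (aff (hv i) (hu j))) (gb (aff (hu j) (hv i)) (aff (hv j) (hu i)))
      (h i j hij) (h j i hij.symm) ?_⟩
    refine le_trans (le_of_eq ?_) (mul_le_mul
      (gbm (gm (hu i) (hv j)) (gm (hv i) (hu j)) (am (hu i) (hv j)) (am (hv i) (hu j)))
      (gbm (gm (hu j) (hv i)) (gm (hv j) (hu i)) (am (hu j) (hv i)) (am (hv j) (hu i)))
      (gb (gm (hu j) (hv i)) (gm (hv j) (hu i))) (gb (aff (hu i) (hv j)) (aff (hv i) (hu j))))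
    simp only [dist _ (hu _) (hv _), dist _ (hv _) (hu _), eδ (hu _), eδ' (hv _)]
    ring
  · refine ⟨β, ⟨b0, b1⟩, fun i j hij => mul_lt_mul_of_rpow_mul_rpow a0 a1 (hd i) (hd j)
      (gb (aff (hu i) (hu j)) (aff (hv i) (hv j))) (gb (aff (hu j) (hu i)) (aff (hv j) (hv i)))
      (h i j hij) (h j i hij.symm) ?_⟩
    refine le_trans (le_of_eq ?_) (mul_le_mul
      (gbm (gm (hu i) (hu j)) (gm (hv i) (hv j)) (am (hu i) (hu j)) (am (hv i) (hv j)))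
      (gbm (gm (hu j) (hu i)) (gm (hv j) (hv i)) (am (hu j) (hu i)) (am (hv j) (hv i)))
      (gb (gm (hu j) (hu i)) (gm (hv j) (hv i))) (gb (aff (hu i) (hu j)) (aff (hv i) (hv j))))
    have e : ∀ {a : ℝ} (s : ℝ), 0 ≤ a → a ^ s = (a ^ α) ^ s * (a ^ (1 - α)) ^ s := fun s ha => by
      rw [← Real.mul_rpow (P _ ha) (P _ ha), one ha]
    rw [dist _ (hu i) (hu j), dist _ (hv i) (hv j), dist _ (hu j) (hu i), dist _ (hv j) (hv i),
      e β (hu i), e β (hu j), e (1 - β) (hv i), e (1 - β) (hv j)]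
    ring

theorem gdd_of_mixed {n : ℕ} (hn : 2 ≤ n) {A : Mat n} {u v : Fin n → ℝ} (hu : NearDom A u)
    (hv : NearDom A v) (hu0 : ∀ i, 0 ≤ u i) (hv0 : ∀ i, 0 ≤ v i) {α β : ℝ}
    (hα : α ∈ Set.Icc (0 : ℝ) 1) (hβ : β ∈ Set.Icc (0 : ℝ) 1)
    (h : Mixed (fun i => ‖A i i‖) u v α β) : GDD A := by
  obtain ⟨γ, hγ, h⟩ := h.exists_geom_mean (fun i => norm_nonneg _) hu0 hv0 hα hβ
  exact gdd_of_geom_mean hn hu hv hγ.1 hγ.2 h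

theorem gdd_of_mixed_or {n : ℕ} (hn : 2 ≤ n) {A : Mat n} {u v : Fin n → ℝ} (hu : NearDom A u)
    (hv : NearDom A v) (hu0 : ∀ i, 0 ≤ u i) (hv0 : ∀ i, 0 ≤ v i) {α β : ℝ}
    (hα : α ∈ Set.Icc (0 : ℝ) 1) (hβ : β ∈ Set.Icc (0 : ℝ) 1)
    (h : Mixed (fun i => ‖A i i‖) u v α β ∨ ∀ i j, i ≠ j →
      ‖A i i‖ ^ α * ‖A j j‖ ^ (1 - α) > α * v i + (1 - α) * v j) : GDD A := by
  rcases h with h | h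
  · exact gdd_of_mixed hn hu hv hu0 hv0 hα hβ h
  -- The additional inequality is the third condition with the two functions exchanged.
  · exact gdd_of_mixed hn hv hu hv0 hu0 hα hβ (.inr (.inr (.inl h)))

end GFun

theorem theorem4p4 (n : ℕ) (hn : 2 ≤ n) (A : Matrix (Fin n) (Fin n) ℂ) :
    -- general `G`-functions
    ((∃ g ∈ GFun.G n, ∃ h ∈ GFun.G n, ∃ α ∈ Set.Icc (0 : ℝ) 1, ∃ β ∈ Set.Icc (0 : ℝ) 1,
        GFun.Mixed (fun i => ‖A i i‖) (g A) (h A) α β) → GFun.GDD A) ∧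
    -- the pair `(r̃^X, c̃^Y)`
    ((∃ x y : Fin n → ℝ, (∀ i, 0 < x i) ∧ (∀ i, 0 < y i) ∧
        ∃ α ∈ Set.Icc (0 : ℝ) 1, ∃ β ∈ Set.Icc (0 : ℝ) 1,
        (GFun.Mixed (fun i => ‖A i i‖) (GFun.rTW x A) (GFun.cTW y A) α β ∨
          ∀ i j, i ≠ j → ‖A i i‖ ^ α * ‖A j j‖ ^ (1 - α) >
            α * GFun.cTW y A i + (1 - α) * GFun.cTW y A j)) → GFun.GDD A) ∧
    -- the pair `(r^X, c^Y)`
    ((∃ x y : Fin n → ℝ, (∀ i, 0 < x i) ∧ (∀ i, 0 < y i) ∧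
        ∃ α ∈ Set.Icc (0 : ℝ) 1, ∃ β ∈ Set.Icc (0 : ℝ) 1,
        (GFun.Mixed (fun i => ‖A i i‖) (GFun.rW x A) (GFun.cW y A) α β ∨
          ∀ i j, i ≠ j → ‖A i i‖ ^ α * ‖A j j‖ ^ (1 - α) >
            α * GFun.cW y A i + (1 - α) * GFun.cW y A j)) → GFun.GDD A) := by
  refine ⟨?_, ?_, ?_⟩
  · rintro ⟨g, hg, h, hh, α, hα, β, hβ, H⟩
    exact GFun.gdd_of_mixed hn (GFun.nearDom_of_mem_G hg A) (GFun.nearDom_of_mem_G hh A)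
      (hg.1.1 A) (hh.1.1 A) hα hβ H
  · rintro ⟨x, y, hx, hy, α, hα, β, hβ, H⟩
    exact GFun.gdd_of_mixed_or hn (GFun.nearDom_rTW A hx) (GFun.nearDom_cTW A hy)
      (GFun.rT_nonneg _) (GFun.cT_nonneg _) hα hβ H
  · rintro ⟨x, y, hx, hy, α, hα, β, hβ, H⟩
    exact GFun.gdd_of_mixed_or hn ((GFun.nearDom_rTW A hx).mono fun i => GFun.rT_le_r _ i)
      ((GFun.nearDom_cTW A hy).mono fun i => GFun.cT_le_c _ i)
      (fun i => (GFun.rT_nonneg _ i).trans (GFun.rT_le_r _ i))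
      (fun i => (GFun.cT_nonneg _ i).trans (GFun.cT_le_c _ i)) hα hβ H
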